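/- Let $G$ be a finite connected groupoid with set of objects $G_0$; for $g : y \to z$ write $s(g)=y$, $t(g)=z$, let $gh$ denote the composite "first $h$, then $g$" (defined when $t(h)=s(g)$), and identify an object $y$ with its identity morphism. Let $A$ be an associative ring and let $\alpha=(A_g,\alpha_g)_{g\in G}$ be a unital partial action of $G$ on $A$. This means: - $A_{t(g)}$ is an ideal of $A$ and $A_g$ is an ideal of $A_{t(g)}$, for all $g\in G$; - each $\alpha_g : A_{g^{-1}}\to A_g$ is a ring isomorphism; - $\alpha_y=\mathrm{id}_{A_y}$ for every object $y$; - $\alpha_{gh}$ extends $\alpha_g\alpha_h$ (which is defined on $\alpha_h^{-1}(A_{g^{-1}}\cap A_h)$) whenever $t(h)=s(g)$; - $A_g=A1_g$ for a central idempotent $1_g$ of $A$, for all $g\in G$. Assume that $A=\bigoplus_{y\in G_0}A_y$ (so that $A$ is unital, with identity $\sum_{y\in G_0} 1_y$), and that $\alpha$ is group-type: there are an object $x$ and morphisms $\tau_y : x\to y$ ($y\in G_0$) with $\tau_x=\mathrm{id}_x$, $A_{\tau_y^{-1}}=A_x$ and $A_{\tau_y}=A_y$ for all $y\in G_0$. Fix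 such $x$ and $(\tau_y)_{y\in G_0}$. Let $A\star_\alpha G$ be the partial skew groupoid ring, that is, the ring of formal sums $\sum_{g\in G}a_g\delta_g$ with $a_g\in A_g$, with the multiplication induced by $(a_g\delta_g)(a_h\delta_h)=a_g\alpha_g(a_h1_{g^{-1}})\delta_{gh}$ if $s(g)=t(h)$, and $(a_g\delta_g)(a_h\delta_h)=0$ otherwise; its identity is $\sum_{y\in G_0}1_y\delta_y$. Regard $A\star_\alpha G$ as a ring extension of $A$ via $a\mapsto\sum_{y\in G_0}(a1_y)\delta_y$. For $a\in A$ put $t_x(a)=\sum_{y\in G_0}\sum_{g : y\to x}\alpha_g(a1_{g^{-1}})$. Denote by $C(R)$ the center of a ring $R$. **Theorem.** Suppose that 1. there is $a_x\in C(A_x)$ with $t_x(a_x)=1_x$, and 2. there is $a\in C(A)$ with $\sum_{z\in G_0}\alpha_{\tau_z^{-1}}(a1_z)=1_x$. Then $A\subset A\star_\alpha G$ is a left semisimple and a right semisimple ring extension: every left (respectively right) $A\star_\alpha G$-submodule $N$ of a left (respectively right) $A\star_\alpha G$-module $M$ that has an $A$-complement in $M$ also has an $A\star_\alpha G$-complement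 in $M$. -/

import Mathlib

open CategoryTheory

universe u v w w'

/-- A partial action `α = (A_g, α_g)` of a groupoid (with objects `Ob`) on an associative, not
necessarily unital, ring `A`.  A morphism `g : y ⟶ z` has source `y` and target `z`; an object `y`
is identified with its identity `𝟙 y`; for `h : y ⟶ z` and `g : z ⟶ t` the product
"`g h`" (first `h`, then `g`) is `h ≫ g`.  `D g` is the ring `A_g` and `map g` is `α_g`. -/
structure PartialGroupoidAction (Ob : Type u) [Groupoid.{v} Ob] (A : Type w) [NonUnitalRing A] where
  /-- the rings `A_g` -/
  D : ∀ {y z : Ob}, (y ⟶ z) → NonUnitalSubring A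
  /-- the ring isomorphisms `α_g : A_{g⁻¹} → A_g` -/
  map : ∀ {y z : Ob} (g : y ⟶ z), D (Groupoid.inv g) ≃+* D g
  /-- `A_g` is an ideal of `A_{t(g)}` -/
  D_le : ∀ {y z : Ob} (g : y ⟶ z), D g ≤ D (𝟙 z)
  mul_mem_D : ∀ {y z : Ob} (g : y ⟶ z) (a b : A), a ∈ D (𝟙 z) → b ∈ D g → a * b ∈ D g
  mem_D_mul : ∀ {y z : Ob} (g : y ⟶ z) (a b : A), a ∈ D g → b ∈ D (𝟙 z) → a * b ∈ D g
  /-- `A_z` is an ideal of `A` -/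
  mul_mem_D_id : ∀ (z : Ob) (a b : A), b ∈ D (𝟙 z) → a * b ∈ D (𝟙 z)
  mem_D_id_mul : ∀ (z : Ob) (a b : A), a ∈ D (𝟙 z) → a * b ∈ D (𝟙 z)
  /-- `α_z` is the identity of `A_z` -/
  map_id : ∀ (z : Ob) (a : D (Groupoid.inv (𝟙 z))), (map (𝟙 z) a : A) = a
  /-- `α_{gh}` extends `α_g ∘ α_h` (whose domain consists of all `a ∈ A_{h⁻¹}` with
  `α_h(a) ∈ A_{g⁻¹}`) -/
  map_comp : ∀ {y z t : Ob} (h : y ⟶ z) (g : z ⟶ t) (a : D (Groupoid.inv h))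
    (ha : (map h a : A) ∈ D (Groupoid.inv g)),
    ∃ ha' : (a : A) ∈ D (Groupoid.inv (h ≫ g)),
      (map (h ≫ g) ⟨a, ha'⟩ : A) = map g ⟨map h a, ha⟩

/-- A unital partial action: `A_g = A 1_g` for a central idempotent `1_g` of `A`, which is then
the identity element of the ring `A_g`, and in particular is determined by `A_g`. -/
structure UnitalPartialGroupoidAction (Ob : Type u) [Groupoid.{v} Ob] (A : Type w)
    [NonUnitalRing A] extends PartialGroupoidAction Ob A where
  /-- the central idempotents `1_g` -/
  e : ∀ {y z : Ob}, (y ⟶ z) → A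
  e_mem_center : ∀ {y z : Ob} (g : y ⟶ z), e g ∈ NonUnitalSubring.center A
  e_idem : ∀ {y z : Ob} (g : y ⟶ z), e g * e g = e g
  mem_D_iff : ∀ {y z : Ob} (g : y ⟶ z) (a : A), a ∈ D g ↔ ∃ b : A, a = b * e g

namespace UnitalPartialGroupoidAction

variable {Ob : Type u} [Groupoid.{v} Ob] {A : Type w} [NonUnitalRing A]
variable (α : UnitalPartialGroupoidAction Ob A)

theorem e_comm {y z : Ob} (g : y ⟶ z) (a : A) : a * α.e g = α.e g * a :=
  (NonUnitalSubring.mem_center_iff.1 (α.e_mem_center g) a)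

theorem mul_e_mem {y z : Ob} (g : y ⟶ z) (a : A) : a * α.e g ∈ α.D g :=
  (α.mem_D_iff g _).2 ⟨a, rfl⟩

theorem e_mem {y z : Ob} (g : y ⟶ z) : α.e g ∈ α.D g :=
  (α.mem_D_iff g _).2 ⟨α.e g, (α.e_idem g).symm⟩

theorem mul_e_of_mem {y z : Ob} (g : y ⟶ z) {a : A} (ha : a ∈ α.D g) : a * α.e g = a := by
  obtain ⟨b, rfl⟩ := (α.mem_D_iff g a).1 ha
  rw [mul_assoc, α.e_idem]

theorem e_mul_of_mem {y z : Ob} (g : y ⟶ z) {a : A} (ha : a ∈ α.D g) : α.e g * a = a := by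
  rw [← α.e_comm, α.mul_e_of_mem g ha]

theorem mul_mem_left {y z : Ob} (g : y ⟶ z) (a : A) {b : A} (hb : b ∈ α.D g) :
    a * b ∈ α.D g := by
  rw [← α.mul_e_of_mem g hb, ← mul_assoc]; exact α.mul_e_mem g _

theorem mul_mem_right {y z : Ob} (g : y ⟶ z) {a : A} (b : A) (ha : a ∈ α.D g) :
    a * b ∈ α.D g := by
  rw [← α.e_mul_of_mem g ha, mul_assoc, ← α.e_comm]; exact α.mul_e_mem g _

/-- The additive map `a ↦ α_g(a 1_{g⁻¹})` from `A` to `A_g`. -/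
def act {y z : Ob} (g : y ⟶ z) : A →+ α.D g where
  toFun a := α.map g ⟨a * α.e (Groupoid.inv g), α.mul_e_mem _ a⟩
  map_zero' := by
    rw [← map_zero (α.map g)]; congr 1; ext; simp
  map_add' a b := by
    rw [← map_add (α.map g)]; congr 1; ext; simp [add_mul]

theorem act_of_mem {y z : Ob} (g : y ⟶ z) {a : A} (ha : a ∈ α.D (Groupoid.inv g)) :
    α.act g a = α.map g ⟨a, ha⟩ := by
  change α.map g _ = _
  congr 1; ext; exact α.mul_e_of_mem _ ha

theorem act_mul {y z : Ob} (g : y ⟶ z) (a b : A) :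
    α.act g (a * b) = α.act g a * α.act g b := by
  change α.map g _ = α.map g _ * α.map g _
  rw [← map_mul]; congr 1; ext
  change a * b * α.e _ = a * α.e _ * (b * α.e _)
  rw [mul_assoc a (α.e _), ← mul_assoc (α.e _) b, ← α.e_comm, mul_assoc b, α.e_idem, mul_assoc]

theorem act_mul_e {y z : Ob} (g : y ⟶ z) (a : A) :
    α.act g (a * α.e (Groupoid.inv g)) = α.act g a := by
  rw [α.act_of_mem g (α.mul_e_mem _ a)]; rfl

theorem act_surj {y z : Ob} (g : y ⟶ z) {b : A} (hb : b ∈ α.D g) :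
    ∃ a ∈ α.D (Groupoid.inv g), (α.act g a : A) = b := by
  refine ⟨(α.map g).symm ⟨b, hb⟩, ((α.map g).symm ⟨b, hb⟩).2, ?_⟩
  rw [α.act_of_mem g ((α.map g).symm ⟨b, hb⟩).2]; simp

theorem act_e {y z : Ob} (g : y ⟶ z) : (α.act g (α.e (Groupoid.inv g)) : A) = α.e g := by
  obtain ⟨a, ha, h⟩ := α.act_surj g (α.e_mem g)
  have h1 := congrArg (Subtype.val) (α.act_mul_e g a)
  rw [α.act_mul, NonUnitalSubring.val_mul, h, α.e_mul_of_mem g (Subtype.prop _)] at h1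
  exact h1

theorem act_id (z : Ob) (a : A) : (α.act (𝟙 z) a : A) = a * α.e (𝟙 z) := by
  change (α.map (𝟙 z) _ : A) = _
  rw [α.map_id]
  change a * α.e (Groupoid.inv (𝟙 z)) = _
  have : Groupoid.inv (𝟙 z) = 𝟙 z := by simp
  rw [this]

theorem act_comp_of_mem {y z t : Ob} (h : y ⟶ z) (g : z ⟶ t) {a : A}
    (ha : a ∈ α.D (Groupoid.inv h)) (ha' : (α.act h a : A) ∈ α.D (Groupoid.inv g)) :
    a ∈ α.D (Groupoid.inv (h ≫ g)) ∧ (α.act g (α.act h a) : A) = α.act (h ≫ g) a := by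
  have e1 := α.act_of_mem h ha
  have hm : (α.map h ⟨a, ha⟩ : A) ∈ α.D (Groupoid.inv g) := by rw [← e1]; exact ha'
  obtain ⟨m, hmm⟩ := α.map_comp h g ⟨a, ha⟩ hm
  refine ⟨m, ?_⟩
  rw [α.act_of_mem g ha', α.act_of_mem (h ≫ g) m, hmm]
  have e2 : (⟨(α.act h a : A), ha'⟩ : α.D (Groupoid.inv g)) = ⟨(α.map h ⟨a, ha⟩ : A), hm⟩ :=
    Subtype.ext (congrArg (fun c : α.D h => (c : A)) e1)
  rw [e2]

/-- `α_g(A_{g⁻¹} ∩ A_h) ⊆ A_{gh}` -/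
theorem act_mem_comp {y z t : Ob} (h : y ⟶ z) (g : z ⟶ t) {b : A} (hb : b ∈ α.D h) :
    (α.act g b : A) ∈ α.D (h ≫ g) := by
  rw [← α.act_mul_e g b]
  obtain ⟨a, ha, e1⟩ := α.act_surj h (α.mul_mem_right h (α.e (Groupoid.inv g)) hb)
  have := (α.act_comp_of_mem h g ha (by rw [e1]; exact α.mul_e_mem _ _)).2
  rw [← e1, this]; exact Subtype.prop _

theorem act_inv_act {y z : Ob} (g : y ⟶ z) {a : A} (ha : a ∈ α.D (Groupoid.inv g)) :
    (α.act (Groupoid.inv g) (α.act g a) : A) = a := by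
  have hm : (α.act g a : A) ∈ α.D (Groupoid.inv (Groupoid.inv g)) := by
    have : Groupoid.inv (Groupoid.inv g) = g := by simp
    rw [this]; exact Subtype.prop _
  rw [(α.act_comp_of_mem g (Groupoid.inv g) ha hm).2]
  have : g ≫ Groupoid.inv g = 𝟙 y := by simp
  rw [this, α.act_id, α.mul_e_of_mem _ (α.D_le _ ha)]

theorem act_act_inv {y z : Ob} (g : y ⟶ z) {b : A} (hb : b ∈ α.D g) :
    (α.act g (α.act (Groupoid.inv g) b) : A) = b := by
  obtain ⟨a, ha, rfl⟩ := α.act_surj g hb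
  rw [α.act_inv_act g ha]

/-- `α_g(1_{g⁻¹} 1_h) = 1_g 1_{gh}` -/
theorem act_e_e {y z t : Ob} (h : y ⟶ z) (g : z ⟶ t) :
    (α.act g (α.e h) : A) = α.e g * α.e (h ≫ g) := by
  have h1 := α.act_mem_comp h g (α.e_mem h)
  have hf : α.e g * α.e (h ≫ g) ∈ α.D g := α.mul_mem_right g _ (α.e_mem g)
  have h2 : (α.act (Groupoid.inv g) (α.e g * α.e (h ≫ g)) : A) ∈ α.D h := by
    have := α.act_mem_comp (h ≫ g) (Groupoid.inv g) (α.mul_e_mem (h ≫ g) (α.e g))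
    simpa using this
  have h3 := congrArg (fun b => (α.act g b : A)) (α.mul_e_of_mem h h2)
  have h4 := congrArg Subtype.val
    (α.act_mul g (α.act (Groupoid.inv g) (α.e g * α.e (h ≫ g)) : A) (α.e h))
  rw [NonUnitalSubring.val_mul, α.act_act_inv g hf] at h4
  simp only [α.act_act_inv g hf] at h3
  rw [h4] at h3
  rw [← h3, mul_assoc, α.e_mul_of_mem _ h1, α.e_mul_of_mem _ (Subtype.prop _)]

theorem act_act {y z t : Ob} (h : y ⟶ z) (g : z ⟶ t) (c : A) :
    (α.act g (α.act h c) : A) = α.e g * α.act (h ≫ g) c := by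
  obtain ⟨d, hd, e1⟩ := α.act_surj h
    (α.mul_mem_right h (α.e (Groupoid.inv g)) (α.act h c).2)
  obtain ⟨p, hp, e2⟩ := α.act_surj h
    (α.mul_mem_right h (α.e (Groupoid.inv g)) (α.e_mem h))
  obtain ⟨p1, p2⟩ := α.act_comp_of_mem h g hp (by rw [e2]; exact α.mul_e_mem _ _)
  have hdm : c * p ∈ α.D (Groupoid.inv h) := α.mul_mem_left _ c hp
  have e3 : (α.act h (c * p) : A) = α.act h c * α.e (Groupoid.inv g) := by
    rw [α.act_mul, NonUnitalSubring.val_mul, e2, ← mul_assoc, α.mul_e_of_mem h (Subtype.prop _)]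
  obtain ⟨-, q2⟩ := α.act_comp_of_mem h g hdm (by rw [e3]; exact α.mul_e_mem _ _)
  rw [e3, α.act_mul_e, α.act_mul, NonUnitalSubring.val_mul, ← p2, e2, α.act_mul_e, α.act_e_e] at q2
  rw [q2, ← mul_assoc, α.e_comm g, mul_assoc, α.mul_e_of_mem _ (Subtype.prop _)]

/-- The underlying set of the partial skew groupoid ring `A ⋆_α G`: all formal (finite) sums
`∑ a_g δ_g` over the morphisms `g` of the groupoid, with `a_g ∈ A_g`. -/
def SkewRing : Type (max u v w) := DirectSum (Quiver.Total Ob) fun g => α.D g.hom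

noncomputable instance : AddCommGroup α.SkewRing :=
  inferInstanceAs (AddCommGroup (DirectSum (Quiver.Total Ob) fun g => α.D g.hom))

namespace SkewRing

open Classical in
/-- `single α g a` is the element `a δ_g` of `A ⋆_α G`. -/
noncomputable def single {y z : Ob} (g : y ⟶ z) : α.D g →+ α.SkewRing :=
  DirectSum.of (fun g : Quiver.Total Ob => α.D g.hom) ⟨y, z, g⟩

/-- The biadditive map `(a, b) ↦ a α_g(b 1_{g⁻¹})`, from `A_g × A_h` to `A_{gh}`. -/
def mulCoeff {y z t : Ob} (g : z ⟶ t) (h : y ⟶ z) : α.D g →+ α.D h →+ α.D (h ≫ g) :=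
  AddMonoidHom.mk' (fun a => AddMonoidHom.mk'
      (fun b => ⟨a * α.act g b, α.mul_mem_left _ _ (α.act_mem_comp h g b.2)⟩)
      (fun b b' => by ext; simp [mul_add]))
    (fun a a' => by ext; simp [add_mul])

open Classical in
/-- The additive map out of `A ⋆_α G` with prescribed values on the elements `a δ_g`. -/
noncomputable def lift {M : Type*} [AddCommMonoid M]
    (f : ∀ g : Quiver.Total Ob, α.D g.hom →+ M) : α.SkewRing →+ M :=
  DirectSum.toAddMonoid (β := fun g : Quiver.Total Ob => α.D g.hom) f

theorem lift_single {M : Type*} [AddCommMonoid M] (f : ∀ g : Quiver.Total Ob, α.D g.hom →+ M)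
    {y z : Ob} (g : y ⟶ z) (a : α.D g) : lift α f (single α g a) = f ⟨y, z, g⟩ a := by
  classical
  exact DirectSum.toAddMonoid_of (β := fun g : Quiver.Total Ob => α.D g.hom) f ⟨y, z, g⟩ a

open Classical in
/-- The product of two homogeneous elements: `(a δ_g)(b δ_h) = a α_g(b 1_{g⁻¹}) δ_{gh}` if
`s(g) = t(h)`, and `0` otherwise. -/
noncomputable def mulSingle : (g h : Quiver.Total Ob) → α.D g.hom →+ α.D h.hom →+ α.SkewRing
  | ⟨z, _, g⟩, ⟨_, z', h⟩ =>
    if hc : z' = z then by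
      subst hc
      exact (AddMonoidHom.compHom (single α (h ≫ g))).comp (mulCoeff α g h)
    else 0

/-- The multiplication of `A ⋆_α G`, the biadditive extension of `mulSingle`. -/
noncomputable def mulHom : α.SkewRing →+ α.SkewRing →+ α.SkewRing :=
  lift α fun g => (lift α fun h => (mulSingle α g h).flip).flip

noncomputable instance : Mul α.SkewRing := ⟨fun p q => mulHom α p q⟩

theorem mul_eq (p q : α.SkewRing) : p * q = mulHom α p q := rfl

theorem mulHom_single {y z y' z' : Ob} (g : y' ⟶ z') (h : y ⟶ z) (a : α.D g) (b : α.D h) :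
    mulHom α (single α g a) (single α h b) = mulSingle α ⟨y', z', g⟩ ⟨y, z, h⟩ a b := by
  rw [mulHom, lift_single, AddMonoidHom.flip_apply, lift_single, AddMonoidHom.flip_apply]

/-- `(a δ_g)(b δ_h) = a α_g(b 1_{g⁻¹}) δ_{gh}` if `s(g) = t(h)` -/
theorem single_mul_single {y z t : Ob} (g : z ⟶ t) (h : y ⟶ z) (a : α.D g) (b : α.D h) :
    single α g a * single α h b =
      single α (h ≫ g) ⟨a * α.act g b, α.mul_mem_left _ _ (α.act_mem_comp h g b.2)⟩ := by
  rw [mul_eq, mulHom_single]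
  simp [mulSingle, mulCoeff]

/-- `(a δ_g)(b δ_h) = 0` if `s(g) ≠ t(h)` -/
theorem single_mul_single_of_ne {y z y' z' : Ob} (g : y' ⟶ z') (h : y ⟶ z) (hne : z ≠ y')
    (a : α.D g) (b : α.D h) : single α g a * single α h b = 0 := by
  rw [mul_eq, mulHom_single]
  simp [mulSingle, hne]

theorem single_congr {y z : Ob} {g g' : y ⟶ z} (hg : g = g') {a : α.D g} {b : α.D g'}
    (hab : (a : A) = b) : single α g a = single α g' b := by
  subst hg
  congr 1
  exact Subtype.ext hab

theorem hom_ext {M : Type*} [AddCommMonoid M] {f f' : α.SkewRing →+ M}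
    (hf : ∀ {y z : Ob} (g : y ⟶ z) (a : α.D g), f (single α g a) = f' (single α g a)) :
    f = f' := by
  classical
  refine DirectSum.addHom_ext (β := fun g : Quiver.Total Ob => α.D g.hom) ?_
  rintro ⟨y, z, g⟩ a
  exact hf g a

@[elab_as_elim]
theorem induction {P : α.SkewRing → Prop} (p : α.SkewRing) (h0 : P 0)
    (h1 : ∀ {y z : Ob} (g : y ⟶ z) (a : α.D g), P (single α g a))
    (h2 : ∀ p q, P p → P q → P (p + q)) : P p := by
  classical
  refine DirectSum.induction_on (β := fun g : Quiver.Total Ob => α.D g.hom) p h0 ?_ h2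
  rintro ⟨y, z, g⟩ a
  exact h1 g a

theorem add_mul' (p q r : α.SkewRing) : (p + q) * r = p * r + q * r := by simp [mul_eq]

theorem mul_add' (p q r : α.SkewRing) : p * (q + r) = p * q + p * r := by simp [mul_eq]

theorem zero_mul' (p : α.SkewRing) : 0 * p = 0 := by simp [mul_eq]

theorem mul_zero' (p : α.SkewRing) : p * 0 = 0 := by simp [mul_eq]

theorem mul_assoc' (p q r : α.SkewRing) : p * q * r = p * (q * r) := by
  induction p using SkewRing.induction with
  | h0 => simp only [zero_mul']
  | h2 p p' hp hp' => simp only [add_mul', hp, hp']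
  | @h1 y₁ z₁ g a =>
    induction q using SkewRing.induction with
    | h0 => simp only [zero_mul', mul_zero']
    | h2 q q' hq hq' => simp only [add_mul', mul_add', hq, hq']
    | @h1 y₂ z₂ h b =>
      induction r using SkewRing.induction with
      | h0 => simp only [mul_zero']
      | h2 r r' hr hr' => simp only [mul_add', hr, hr']
      | @h1 y₃ z₃ k c =>
        by_cases e1 : z₂ = y₁
        · subst e1
          by_cases e2 : z₃ = y₂
          · subst e2
            simp only [single_mul_single]
            refine single_congr α (Category.assoc _ _ _).symm ?_
            change (a : A) * α.act g b * α.act (h ≫ g) c = a * α.act g (b * α.act h c)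
            rw [α.act_mul, NonUnitalSubring.val_mul, α.act_act, ← mul_assoc (α.act g b : A),
              α.mul_e_of_mem g (Subtype.prop _), mul_assoc]
          · rw [single_mul_single, single_mul_single_of_ne _ _ _ e2,
              single_mul_single_of_ne _ _ _ e2, mul_zero']
        · rw [single_mul_single_of_ne _ _ _ e1, zero_mul']
          by_cases e2 : z₃ = y₂
          · subst e2
            rw [single_mul_single, single_mul_single_of_ne _ _ _ e1]
          · rw [single_mul_single_of_ne _ _ _ e2, mul_zero']

section Unital

variable [Fintype Ob]

/-- The identity element `∑_y 1_y δ_y` of `A ⋆_α G`. -/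
noncomputable instance : One α.SkewRing :=
  ⟨∑ y : Ob, single α (𝟙 y) ⟨α.e (𝟙 y), α.e_mem (𝟙 y)⟩⟩

theorem one_def : (1 : α.SkewRing) = ∑ y : Ob, single α (𝟙 y) ⟨α.e (𝟙 y), α.e_mem (𝟙 y)⟩ := rfl

theorem sum_mul' (f : Ob → α.SkewRing) (p : α.SkewRing) : (∑ y, f y) * p = ∑ y, f y * p := by
  simp [mul_eq]

theorem mul_sum' (f : Ob → α.SkewRing) (p : α.SkewRing) : p * (∑ y, f y) = ∑ y, p * f y := by
  simp [mul_eq]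

theorem one_mul' (p : α.SkewRing) : 1 * p = p := by
  induction p using SkewRing.induction with
  | h0 => rw [mul_zero']
  | h2 p q hp hq => rw [mul_add', hp, hq]
  | @h1 y z g a =>
    rw [one_def, sum_mul', Finset.sum_eq_single z]
    · rw [single_mul_single]
      refine single_congr α (Category.comp_id g) ?_
      change α.e (𝟙 z) * α.act (𝟙 z) a = a
      have ha := α.D_le g a.2
      rw [α.act_id, α.mul_e_of_mem _ ha, α.e_mul_of_mem _ ha]
    · intro y' _ hy'
      exact single_mul_single_of_ne _ _ _ hy'.symm _ _
    · simp

theorem mul_one' (p : α.SkewRing) : p * 1 = p := by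
  induction p using SkewRing.induction with
  | h0 => rw [zero_mul']
  | h2 p q hp hq => rw [add_mul', hp, hq]
  | @h1 y z g a =>
    rw [one_def, mul_sum', Finset.sum_eq_single y]
    · rw [single_mul_single]
      refine single_congr α (Category.id_comp g) ?_
      change (a : A) * α.act g (α.e (𝟙 y)) = a
      rw [α.act_e_e, Category.id_comp, α.e_idem, α.mul_e_of_mem g a.2]
    · intro y' _ hy'
      exact single_mul_single_of_ne _ _ _ hy' _ _
    · simp

/-- The unital associative ring `A ⋆_α G`, when the groupoid has finitely many objects. -/
noncomputable instance : Ring α.SkewRing where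
  __ := (inferInstance : AddCommGroup α.SkewRing)
  __ := (inferInstance : Mul α.SkewRing)
  __ := (inferInstance : One α.SkewRing)
  left_distrib := mul_add' α
  right_distrib := add_mul' α
  zero_mul := zero_mul' α
  mul_zero := mul_zero' α
  mul_assoc := mul_assoc' α
  one_mul := one_mul' α
  mul_one := mul_one' α

/-- The ring homomorphism `A → A ⋆_α G`, `a ↦ ∑_y (a 1_y) δ_y`, which makes `A ⋆_α G` a ring
extension of `A`. -/
noncomputable def incl : A →ₙ+* α.SkewRing where
  toFun a := ∑ y : Ob, single α (𝟙 y) ⟨a * α.e (𝟙 y), α.mul_e_mem (𝟙 y) a⟩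
  map_zero' := by
    refine Finset.sum_eq_zero fun y _ => ?_
    rw [← map_zero (single α (𝟙 y))]; congr 1; ext; simp
  map_add' a b := by
    rw [← Finset.sum_add_distrib]
    refine Finset.sum_congr rfl fun y _ => ?_
    rw [← map_add (single α (𝟙 y))]; congr 1; ext; simp [add_mul]
  map_mul' a b := by
    refine Eq.trans ?_ (sum_mul' α _ _).symm
    refine Finset.sum_congr rfl fun y _ => ?_
    refine Eq.trans ?_ (mul_sum' α _ _).symm
    rw [Finset.sum_eq_single y]
    · rw [single_mul_single]
      refine single_congr α (Category.comp_id _).symm ?_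
      change a * b * α.e (𝟙 y) = a * α.e (𝟙 y) * (α.act (𝟙 y) (b * α.e (𝟙 y)))
      rw [α.act_id, mul_assoc b, α.e_idem, mul_assoc a (α.e _), ← mul_assoc (α.e _) b,
        ← α.e_comm, mul_assoc b, α.e_idem, mul_assoc]
    · intro y' _ hy'
      exact single_mul_single_of_ne _ _ _ hy' _ _
    · simp

end Unital

end SkewRing

/-- The map `t_{y,z} : A → A`, `t_{y,z}(a) = ∑_{g : y → z} α_g(a 1_{g⁻¹})`. -/
def traceHom (y z : Ob) [Fintype (y ⟶ z)] (a : A) : A :=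
  ∑ g : y ⟶ z, (α.act g a : A)

/-- The partial trace `t_z : A → A`, `t_z(a) = ∑_y t_{y,z}(a)`. -/
def trace [Fintype Ob] [∀ y z : Ob, Fintype (y ⟶ z)] (z : Ob) (a : A) : A :=
  ∑ y : Ob, α.traceHom y z a

end UnitalPartialGroupoidAction

/-- A ring extension, given by `f : R → S`, is left semisimple if every `S`-submodule `N` of a
left `S`-module `M` which has an `R`-complement in `M` (a complement that is stable under `R`,
acting through `f`) has an `S`-complement in `M`. -/
def IsLeftSemisimpleExtension {R : Type u} {S : Type v} [NonUnitalRing R] [Ring S]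
    (f : R →ₙ+* S) : Prop :=
  ∀ (M : Type w') [AddCommGroup M] [Module S M] (N : Submodule S M),
    (∃ K : AddSubgroup M, (∀ r : R, ∀ k ∈ K, f r • k ∈ K) ∧ IsCompl N.toAddSubgroup K) →
      ∃ K : Submodule S M, IsCompl N K

/-- A ring extension, given by `f : R → S`, is right semisimple if every `S`-submodule `N` of a
right `S`-module `M` (a module over `Sᵐᵒᵖ`) which has an `R`-complement in `M` has an
`S`-complement in `M`. -/
def IsRightSemisimpleExtension {R : Type u} {S : Type v} [NonUnitalRing R] [Ring S]
    (f : R →ₙ+* S) : Prop :=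
  ∀ (M : Type w') [AddCommGroup M] [Module Sᵐᵒᵖ M] (N : Submodule Sᵐᵒᵖ M),
    (∃ K : AddSubgroup M, (∀ r : R, ∀ k ∈ K, MulOpposite.op (f r) • k ∈ K) ∧
        IsCompl N.toAddSubgroup K) →
      ∃ K : Submodule Sᵐᵒᵖ M, IsCompl N K

/-! ### Separable ring extensions are semisimple on both sides. -/

section AveragingProjections

/-! The proof is Maschke's averaging argument. If `∑ p_i ⊗ q_i` is a separability element of `S`
over `R` and `π` is an `R`-linear projection onto a submodule `N`, then `m ↦ ∑ p_i π(q_i m)` is an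
`S`-linear projection onto `N`, and its kernel is the required complement; right modules are treated
symmetrically.

For `A ⋆_α G` the element is `∑_g α_g(c 1_{g⁻¹}) δ_g ⊗ 1_{g⁻¹} δ_{g⁻¹}`, with `c` central in `A` and
`t_y(c) = 1_y` at every object `y` (`SkewRing.isSeparabilityElement`). The trace condition makes the
product equal to `1`; centrality of `c` gives the Casimir identity.

Such a `c` comes from the group-type structure (`exists_trace_eq_e`): `c = a ∑_z α_{τ_z}(a_x)`. Each
`g : z → y` is uniquely `τ_y k τ_z⁻¹` with `k` in the isotropy group of `x`, and `α_g(c 1_{g⁻¹})`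
becomes `α_{τ_y}(α_k(α_{τ_z⁻¹}(a 1_z) a_x 1_{k⁻¹}))`. Summing over `z` turns the factor containing
`a` into `1_x`, summing over `k` then gives `t_x(a_x) = 1_x`, and `α_{τ_y}` sends `1_x` to `1_y`. -/

/-- An additive complement that is stable under a family of scalars gives an additive projection
that commutes with these scalars. -/
theorem exists_addMonoidHom_proj {R : Type*} {T : Type*} [Ring T] (f : R → T) {M : Type*}
    [AddCommGroup M] [Module T M] (N : Submodule T M) (K : AddSubgroup M)
    (hK : ∀ r : R, ∀ k ∈ K, f r • k ∈ K) (hc : IsCompl N.toAddSubgroup K) :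
    ∃ π : M →+ M, (∀ m, π m ∈ N) ∧ (∀ n ∈ N, π n = n) ∧ ∀ r m, π (f r • m) = f r • π m := by
  -- `K` is only an additive subgroup, so the projection is taken over `ℤ`; compatibility with `f`
  -- is then checked on each summand.
  have hc' : IsCompl (AddSubgroup.toIntSubmodule N.toAddSubgroup)
      (AddSubgroup.toIntSubmodule K) := hc.map AddSubgroup.toIntSubmodule
  let ρ := Submodule.projectionOnto _ _ hc'
  have hN : ∀ n ∈ N, (ρ n : M) = n := fun n hn =>
    congrArg Subtype.val (Submodule.projectionOnto_apply_left hc' ⟨n, hn⟩)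
  have hρK : ∀ k ∈ K, (ρ k : M) = 0 := fun k hk =>
    congrArg Subtype.val (Submodule.projectionOnto_apply_right hc' ⟨k, hk⟩)
  refine ⟨((AddSubgroup.toIntSubmodule N.toAddSubgroup).subtype ∘ₗ ρ).toAddMonoidHom,
    fun m => (ρ m).2, hN, fun r m => ?_⟩
  change (ρ (f r • m) : M) = f r • (ρ m : M)
  have hm : m ∈ AddSubgroup.toIntSubmodule N.toAddSubgroup ⊔ AddSubgroup.toIntSubmodule K := by
    rw [hc'.sup_eq_top]; trivial
  obtain ⟨n, hn, k, hk, rfl⟩ := Submodule.mem_sup.1 hm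
  have hn' : n ∈ N := hn
  rw [smul_add, map_add, map_add, Submodule.coe_add, Submodule.coe_add,
    hN _ (N.smul_mem _ hn'), hρK _ (hK r k hk), hN n hn', hρK k hk, add_zero, add_zero]

/-- The kernel of an additive projection onto `N` that commutes with all scalars is a
complement of `N`. -/
theorem exists_isCompl_of_addMonoidHom_proj {T : Type*} [Ring T] {M : Type*} [AddCommGroup M]
    [Module T M] (N : Submodule T M) (π : M →+ M) (h1 : ∀ m, π m ∈ N) (h2 : ∀ n ∈ N, π n = n)
    (h3 : ∀ (s : T) m, π (s • m) = s • π m) : ∃ K : Submodule T M, IsCompl N K :=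
  let ρ : M →ₗ[T] N :=
    { toFun := fun m => ⟨π m, h1 m⟩
      map_add' := fun a b => Subtype.ext (map_add π a b)
      map_smul' := fun s m => Subtype.ext (h3 s m) }
  ⟨LinearMap.ker ρ, LinearMap.isCompl_of_proj (f := ρ) fun n => Subtype.ext (h2 n n.2)⟩

/-- `∑ u_i ⊗ v_i` is a separability element of the ring extension `f : R → S`.  The identity
`s (∑ u_i ⊗ v_i) = (∑ u_i ⊗ v_i) s` in `S ⊗_R S` is expressed by `R`-balanced biadditive maps. -/
structure IsSeparabilityElement {R : Type u} {S : Type v} [NonUnitalRing R] [Ring S]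
    (f : R →ₙ+* S) {ι : Type*} [Fintype ι] (p q : ι → S) : Prop where
  sum_mul : ∑ i, p i * q i = 1
  casimir : ∀ {P : Type w'} [AddCommGroup P] (B : S →+ S →+ P),
    (∀ s r t, B (s * f r) t = B s (f r * t)) →
      ∀ s, ∑ i, B (s * p i) (q i) = ∑ i, B (p i) (q i * s)

variable {R : Type u} {S : Type v} [NonUnitalRing R] [Ring S] {f : R →ₙ+* S}
  {ι : Type*} [Fintype ι] {p q : ι → S}

theorem IsSeparabilityElement.isLeftSemisimpleExtension
    (h : IsSeparabilityElement.{u, v, w'} f p q) : IsLeftSemisimpleExtension.{u, v, w'} f := by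
  rintro M _ _ N ⟨K, hK, hc⟩
  obtain ⟨π, h1, h2, h3⟩ := exists_addMonoidHom_proj f N K hK hc
  refine exists_isCompl_of_addMonoidHom_proj N
    (∑ i, (DistribSMul.toAddMonoidHom M (p i)).comp (π.comp (DistribSMul.toAddMonoidHom M (q i))))
    (fun m => ?_) (fun n hn => ?_) (fun s m => ?_)
  · rw [AddMonoidHom.finsetSum_apply]
    exact N.sum_mem fun i _ => N.smul_mem _ (h1 _)
  · simp only [AddMonoidHom.finsetSum_apply, AddMonoidHom.comp_apply,
      DistribSMul.toAddMonoidHom_apply, h2 _ (N.smul_mem _ hn), smul_smul]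
    rw [← Finset.sum_smul, h.sum_mul, one_smul]
  -- `B(s, t) = s π(t m)` is balanced because `π` commutes with `R`; its Casimir identity is the
  -- `S`-linearity of the average.
  · let B : S →+ S →+ M := AddMonoidHom.mk' (fun s => AddMonoidHom.mk' (fun t => s • π (t • m))
        (fun t t' => by rw [add_smul, map_add, smul_add]))
        (fun s s' => by ext t; exact add_smul _ _ _)
    have := h.casimir B (fun s r t => by
      change (s * f r) • π (t • m) = s • π ((f r * t) • m)
      rw [mul_smul, mul_smul, h3]) s
    simp only [AddMonoidHom.finsetSum_apply, AddMonoidHom.comp_apply,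
      DistribSMul.toAddMonoidHom_apply, Finset.smul_sum, smul_smul]
    exact this.symm

/-- The mirror average is `m ↦ ∑ π(m p_i) q_i`: the two tensor legs exchange roles. -/
theorem IsSeparabilityElement.isRightSemisimpleExtension
    (h : IsSeparabilityElement.{u, v, w'} f p q) : IsRightSemisimpleExtension.{u, v, w'} f := by
  rintro M _ _ N ⟨K, hK, hc⟩
  obtain ⟨π, h1, h2, h3⟩ := exists_addMonoidHom_proj (fun r => MulOpposite.op (f r)) N K hK hc
  refine exists_isCompl_of_addMonoidHom_proj N
    (∑ i, (DistribSMul.toAddMonoidHom M (MulOpposite.op (q i))).comp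
      (π.comp (DistribSMul.toAddMonoidHom M (MulOpposite.op (p i)))))
    (fun m => ?_) (fun n hn => ?_) (fun s m => ?_)
  · rw [AddMonoidHom.finsetSum_apply]
    exact N.sum_mem fun i _ => N.smul_mem _ (h1 _)
  · simp only [AddMonoidHom.finsetSum_apply, AddMonoidHom.comp_apply,
      DistribSMul.toAddMonoidHom_apply, h2 _ (N.smul_mem _ hn), smul_smul, ← MulOpposite.op_mul]
    rw [← Finset.sum_smul, ← Finset.op_sum, h.sum_mul, MulOpposite.op_one, one_smul]
  · let B : S →+ S →+ M := AddMonoidHom.mk' (fun s => AddMonoidHom.mk'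
        (fun t => MulOpposite.op t • π (MulOpposite.op s • m))
        (fun t t' => by rw [MulOpposite.op_add, add_smul]))
        (fun s s' => by
          ext t
          change MulOpposite.op t • π (MulOpposite.op (s + s') • m) =
            MulOpposite.op t • π (MulOpposite.op s • m) +
              MulOpposite.op t • π (MulOpposite.op s' • m)
          rw [MulOpposite.op_add, add_smul, map_add, smul_add])
    have := h.casimir B (fun s r t => by
      change MulOpposite.op t • π (MulOpposite.op (s * f r) • m) =
        MulOpposite.op (f r * t) • π (MulOpposite.op s • m)
      rw [MulOpposite.op_mul, MulOpposite.op_mul, mul_smul, mul_smul, h3]) s.unop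
    simp only [AddMonoidHom.finsetSum_apply, AddMonoidHom.comp_apply,
      DistribSMul.toAddMonoidHom_apply, Finset.smul_sum, smul_smul]
    exact this

end AveragingProjections

/-! ### Composition, orthogonality and traces for partial actions. -/

namespace UnitalPartialGroupoidAction

section

variable {Ob : Type u} [Groupoid.{v} Ob] {A : Type w} [NonUnitalRing A]
variable (α : UnitalPartialGroupoidAction Ob A)

/-- Both idempotents are identity elements of the same ring. -/
theorem e_eq_of_D_eq {y z y' z' : Ob} {g : y ⟶ z} {h : y' ⟶ z'} (hD : α.D g = α.D h) :
    α.e g = α.e h := by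
  have h1 : α.e g * α.e h = α.e g := α.mul_e_of_mem h (hD ▸ α.e_mem g)
  have h2 : α.e g * α.e h = α.e h := α.e_mul_of_mem g (hD ▸ α.e_mem h)
  rw [← h1, h2]

theorem coe_map_sum {κ B : Type*} [Fintype κ] [NonUnitalRing B] {D : NonUnitalSubring B}
    {M : Type*} [AddCommMonoid M] (φ : M →+ D) (c : κ → M) :
    (φ (∑ i, c i) : B) = ∑ i, (φ (c i) : B) :=
  map_sum ((NonUnitalSubringClass.subtype D : D →+ B).comp φ) c Finset.univ

/-- `α_g α_h = α_{gh}` if `α_h` is defined on all of `A_{s(h)}` -/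
theorem act_act_of_D_inv_eq {y z t : Ob} (h : y ⟶ z) (g : z ⟶ t)
    (hh : α.D (Groupoid.inv h) = α.D (𝟙 y)) (c : A) :
    (α.act g (α.act h c) : A) = α.act (h ≫ g) c := by
  rw [α.act_act]
  refine α.e_mul_of_mem g ?_
  rw [← α.act_mul_e]
  -- What is needed is that `α_{gh}` takes values in `A_g`. Its domain lies in `A_{s(h)} = A_{h⁻¹}`,
  -- so its image lies in `A_{(gh)h⁻¹} = A_g`.
  have := α.act_mem_comp (Groupoid.inv h) (h ≫ g)
    (b := c * α.e (Groupoid.inv (h ≫ g))) (by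
      rw [hh]
      exact α.D_le _ (α.mul_e_mem _ c))
  simpa using this

/-- `α_g α_h = α_{gh}` if the image of `α_g` is all of `A_{t(g)}` -/
theorem act_act_of_D_eq {y z t : Ob} (h : y ⟶ z) (g : z ⟶ t)
    (hg : α.D g = α.D (𝟙 t)) (c : A) :
    (α.act g (α.act h c) : A) = α.act (h ≫ g) c := by
  rw [α.act_act]
  refine α.e_mul_of_mem g ?_
  rw [hg]
  exact α.D_le _ (Subtype.prop _)

/-- The product lies in both ideals `A_y` and `A_z`, which meet in zero because the sum is direct.
-/
theorem e_id_mul_e_id_of_ne [DecidableEq Ob]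
    (hA : DirectSum.IsInternal fun y : Ob => α.D (𝟙 y)) {y z : Ob} (hyz : y ≠ z) :
    α.e (𝟙 y) * α.e (𝟙 z) = 0 := by
  set b := α.e (𝟙 y) * α.e (𝟙 z)
  have hy : b ∈ α.D (𝟙 y) := α.mul_mem_right _ _ (α.e_mem _)
  have hz : b ∈ α.D (𝟙 z) := α.mul_e_mem _ _
  have h1 : DirectSum.of (fun y : Ob => α.D (𝟙 y)) y ⟨b, hy⟩ =
      DirectSum.of (fun y : Ob => α.D (𝟙 y)) z ⟨b, hz⟩ :=
    hA.1 (by rw [DirectSum.coeAddMonoidHom_of, DirectSum.coeAddMonoidHom_of])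
  have h2 := DFunLike.congr_fun h1 y
  rw [DirectSum.of_eq_same, DirectSum.of_eq_of_ne _ _ _ hyz] at h2
  exact congrArg Subtype.val h2

theorem mul_e_id_of_mem_of_ne [DecidableEq Ob]
    (hA : DirectSum.IsInternal fun y : Ob => α.D (𝟙 y)) {y z : Ob} (hyz : y ≠ z) {b : A}
    (hb : b ∈ α.D (𝟙 y)) : b * α.e (𝟙 z) = 0 := by
  rw [← α.mul_e_of_mem _ hb, mul_assoc, α.e_id_mul_e_id_of_ne hA hyz, mul_zero]

/-- `α_g` only depends on the component in `A_{s(g)}` -/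
theorem act_mul_e_id {y z : Ob} (g : y ⟶ z) (c : A) :
    α.act g (c * α.e (𝟙 y)) = α.act g c := by
  rw [← α.act_mul_e, mul_assoc, α.e_mul_of_mem _ (α.D_le _ (α.e_mem _)), α.act_mul_e]

/-- A morphism with source `y ≠ x` sees only the `A_y`-component of `a`, which vanishes. -/
theorem trace_eq_traceHom [DecidableEq Ob] [Fintype Ob] [∀ y z : Ob, Fintype (y ⟶ z)]
    (hA : DirectSum.IsInternal fun y : Ob => α.D (𝟙 y)) {x : Ob} {a : A} (ha : a ∈ α.D (𝟙 x)) :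
    α.trace x a = α.traceHom x x a := by
  refine Finset.sum_eq_single x (fun y _ hy => ?_) (by simp)
  refine Finset.sum_eq_zero fun g _ => ?_
  rw [← α.act_mul_e_id, α.mul_e_id_of_mem_of_ne hA hy.symm ha, map_zero]
  rfl

/-- The image under `α_g` of an element of the center of `A_{s(g)}` is central in `A`. -/
theorem commute_act {y z : Ob} (g : y ⟶ z) {a : A} (ha : ∀ b ∈ α.D (𝟙 y), a * b = b * a) (b : A) :
    (α.act g a : A) * b = b * α.act g a := by
  have hb := α.mul_e_mem g b
  -- Since `α_g(a 1_{g⁻¹})` lies in `A_g`, only `b 1_g` matters; this is the image of some `d` in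
  -- `A_{s(g)}`, with which `a` commutes.
  obtain ⟨d, hd, e1⟩ := α.act_surj g hb
  have h1 := congrArg (fun c => (α.act g c : A)) (ha d (α.D_le _ hd))
  simp only [α.act_mul, NonUnitalSubring.val_mul, e1] at h1
  rwa [α.e_comm, ← mul_assoc, α.mul_e_of_mem g (Subtype.prop _), ← α.e_comm, mul_assoc,
    α.e_mul_of_mem g (Subtype.prop _)] at h1

/-- In a group-type partial action, elements `a_x ∈ C(A_x)` of trace `1_x` and `a ∈ C(A)` with
`∑_z α_{τ_z⁻¹}(a 1_z) = 1_x` give a central element of `A` all of whose partial traces are the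
identity elements. -/
theorem exists_trace_eq_e [DecidableEq Ob] [Fintype Ob] [∀ y z : Ob, Fintype (y ⟶ z)]
    (hA : DirectSum.IsInternal fun y : Ob => α.D (𝟙 y))
    (x : Ob) (τ : ∀ y : Ob, x ⟶ y)
    (hτ : ∀ y : Ob, α.D (Groupoid.inv (τ y)) = α.D (𝟙 x) ∧ α.D (τ y) = α.D (𝟙 y))
    (h₁ : ∃ a ∈ NonUnitalSubring.center (α.D (𝟙 x)), α.trace x (a : A) = α.e (𝟙 x))
    (h₂ : ∃ a ∈ NonUnitalSubring.center A,
      ∑ z : Ob, (α.act (Groupoid.inv (τ z)) (a * α.e (𝟙 z)) : A) = α.e (𝟙 x)) :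
    ∃ c : A, (∀ b, c * b = b * c) ∧ ∀ y, α.trace y c = α.e (𝟙 y) := by
  obtain ⟨⟨ax, hax⟩, hac, htr⟩ := h₁
  obtain ⟨a, ha, hsum⟩ := h₂
  have hac' : ∀ b ∈ α.D (𝟙 x), ax * b = b * ax := fun b hb =>
    (congrArg Subtype.val (NonUnitalSubring.mem_center_iff.1 hac ⟨b, hb⟩)).symm
  have ha' : ∀ b, a * b = b * a := fun b => (NonUnitalSubring.mem_center_iff.1 ha b).symm
  rw [α.trace_eq_traceHom hA hax] at htr
  -- The `A_z`-component of the witness: orthogonality kills every term with `w ≠ z`.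
  have hce : ∀ z, (a * ∑ w, (α.act (τ w) ax : A)) * α.e (𝟙 z) = a * α.e (𝟙 z) * α.act (τ z) ax := by
    intro z
    have hmem : ∀ w, (α.act (τ w) ax : A) ∈ α.D (𝟙 w) := fun w => α.D_le _ (Subtype.prop _)
    rw [mul_assoc, Finset.sum_mul, Finset.sum_eq_single z, mul_assoc, α.e_comm]
    · exact fun w _ hw => α.mul_e_id_of_mem_of_ne hA hw (hmem w)
    · simp
  refine ⟨a * ∑ z, (α.act (τ z) ax : A), fun b => ?_, fun y => ?_⟩
  · rw [mul_assoc, Finset.sum_mul, Finset.sum_congr rfl fun z _ => α.commute_act (τ z) hac' b,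
      ← Finset.mul_sum, ← mul_assoc, ha', mul_assoc]
  · have hz : ∀ z : Ob, α.traceHom z y (a * ∑ w, (α.act (τ w) ax : A)) =
        α.act (τ y) (α.traceHom x x (α.act (Groupoid.inv (τ z)) (a * α.e (𝟙 z)) * ax)) := by
      intro z
      rw [traceHom, traceHom, coe_map_sum]
      -- Transport along `τ` identifies each hom-set with the isotropy group of `x`.
      let E : (x ⟶ x) ≃ (z ⟶ y) :=
        { toFun := fun k => (Groupoid.inv (τ z) ≫ k) ≫ τ y
          invFun := fun g => τ z ≫ g ≫ Groupoid.inv (τ y)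
          left_inv := fun k => by simp
          right_inv := fun g => by simp }
      refine (Fintype.sum_equiv E _ _ fun k => ?_).symm
      change _ = (α.act ((Groupoid.inv (τ z) ≫ k) ≫ τ y) _ : A)
      have hinv : (α.act (Groupoid.inv (τ z)) (a * α.e (𝟙 z)) * ax : A) =
          α.act (Groupoid.inv (τ z)) (a * α.e (𝟙 z) * α.act (τ z) ax) := by
        rw [α.act_mul _ (a * α.e (𝟙 z)), NonUnitalSubring.val_mul, α.act_inv_act _ (by rw [(hτ z).1]; exact hax)]
      -- The composites are exact, with no idempotent factor: `α_{τ_z⁻¹}` is defined on all of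
      -- `A_z`, and `α_{τ_y}` has image all of `A_y`.
      rw [← α.act_mul_e_id _ (a * ∑ w, (α.act (τ w) ax : A)), hce, hinv,
        α.act_act_of_D_inv_eq _ k (by simpa using (hτ z).2), α.act_act_of_D_eq _ _ (hτ y).2]
    rw [trace, Finset.sum_congr rfl fun z _ => hz z, ← coe_map_sum]
    have : ∑ z, α.traceHom x x (α.act (Groupoid.inv (τ z)) (a * α.e (𝟙 z)) * ax) =
        α.e (𝟙 x) := by
      simp only [traceHom]
      -- With `k` fixed, the sum over `z` collapses to `1_x a_x = a_x` by the hypothesis on `a`.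
      rw [Finset.sum_comm, ← htr, traceHom]
      refine Finset.sum_congr rfl fun k _ => ?_
      rw [← coe_map_sum, ← Finset.sum_mul, hsum, α.e_mul_of_mem _ hax]
    rw [this, ← α.e_eq_of_D_eq (hτ y).1, α.act_e, α.e_eq_of_D_eq (hτ y).2]

/-! ### The separability element of the partial skew groupoid ring. -/

namespace SkewRing

variable [Fintype Ob]

theorem incl_apply (r : A) :
    incl α r = ∑ y : Ob, single α (𝟙 y) ⟨r * α.e (𝟙 y), α.mul_e_mem (𝟙 y) r⟩ := rfl

/-- Moving a scalar from the right of `δ_g` to its left twists it by `α_g`; this carries scalars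
across the tensor sign in the Casimir identity. -/
theorem single_mul_incl {y z : Ob} (g : y ⟶ z) (a : α.D g) (r : A) :
    single α g a * incl α r = single α g (a * α.act g r) := by
  rw [incl_apply, mul_sum', Finset.sum_eq_single y]
  · rw [single_mul_single]
    refine single_congr α (Category.id_comp g) ?_
    rw [NonUnitalSubring.val_mul]
    exact congrArg (fun b : α.D g => (a : A) * b) (α.act_mul_e_id g r)
  · exact fun y' _ hy' => single_mul_single_of_ne _ _ _ hy' _ _
  · simp

theorem incl_mul_single {y z : Ob} (g : y ⟶ z) (a : α.D g) (r : A) :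
    incl α r * single α g a = single α g ⟨r * a, α.mul_mem_left g r a.2⟩ := by
  rw [incl_apply, sum_mul', Finset.sum_eq_single z]
  · rw [single_mul_single]
    refine single_congr α (Category.comp_id g) ?_
    change r * α.e (𝟙 z) * α.act (𝟙 z) a = r * a
    have ha := α.D_le g a.2
    rw [α.act_id, α.mul_e_of_mem _ ha, mul_assoc, α.e_mul_of_mem _ ha]
  · exact fun y' _ hy' => single_mul_single_of_ne _ _ _ hy'.symm _ _
  · simp

/-- A central element `c` of `A` all of whose partial traces are the identity elements gives the
separability element `∑_g α_g(c 1_{g⁻¹}) δ_g ⊗ 1_{g⁻¹} δ_{g⁻¹}` of `A ⋆_α G` over `A`. -/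
theorem isSeparabilityElement [∀ y z : Ob, Fintype (y ⟶ z)] {c : A} (hc : ∀ b, c * b = b * c)
    (htr : ∀ y, α.trace y c = α.e (𝟙 y)) :
    IsSeparabilityElement.{w, max u v w, w'} (incl α)
      (fun i : Σ (z : Ob) (y : Ob), (y ⟶ z) => single α i.2.2 (α.act i.2.2 c))
      (fun i => single α (Groupoid.inv i.2.2) ⟨_, α.e_mem (Groupoid.inv i.2.2)⟩) where
  sum_mul := by
    rw [Fintype.sum_sigma, one_def]
    refine Finset.sum_congr rfl fun z _ => ?_
    rw [Fintype.sum_sigma]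
    have h : ∀ (y : Ob) (g : y ⟶ z), single α g (α.act g c) *
        single α (Groupoid.inv g) ⟨_, α.e_mem (Groupoid.inv g)⟩ =
          single α (𝟙 z) ⟨α.act g c, α.D_le g (Subtype.prop _)⟩ := by
      intro y g
      rw [single_mul_single]
      refine single_congr α (Groupoid.inv_comp g) ?_
      change (α.act g c : A) * α.act g (α.e (Groupoid.inv g)) = α.act g c
      rw [α.act_e, α.mul_e_of_mem g (Subtype.prop _)]
    simp only [h, ← map_sum]
    refine single_congr α rfl ?_
    refine Eq.trans ?_ (htr z)
    simp only [AddSubmonoidClass.coe_finsetSum, trace, traceHom]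
  casimir := by
    intro P _ B hB s
    induction s using SkewRing.induction with
    | h0 => simp
    | h2 s t hs ht =>
      simp only [add_mul, mul_add, map_add, AddMonoidHom.add_apply, Finset.sum_add_distrib, hs, ht]
    | @h1 y z h b =>
      -- The outer index is the target: `b δ_h` on the left keeps only morphisms into `y = s(h)`, on
      -- the right only those into `z = t(h)`. Composition with `h` matches the two families.
      rw [Fintype.sum_sigma, Fintype.sum_sigma, Finset.sum_eq_single y, Finset.sum_eq_single z,
        Fintype.sum_sigma, Fintype.sum_sigma]
      · refine Finset.sum_congr rfl fun p _ => ?_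
        let E : (p ⟶ y) ≃ (p ⟶ z) :=
          { toFun := fun g => g ≫ h
            invFun := fun g => g ≫ Groupoid.inv h
            left_inv := fun g => by simp
            right_inv := fun g => by simp }
        refine Fintype.sum_equiv E _ _ fun g => ?_
        change B (single α h b * single α g (α.act g c)) (single α (Groupoid.inv g) ⟨_, α.e_mem (Groupoid.inv g)⟩) =
          B (single α (g ≫ h) (α.act (g ≫ h) c))
            (single α (Groupoid.inv (g ≫ h)) ⟨_, α.e_mem (Groupoid.inv (g ≫ h))⟩ * single α h b)
        generalize hk : g ≫ h = k
        have hinv : h ≫ Groupoid.inv k = Groupoid.inv g := by simp [← hk]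
        have hmem : (α.act (Groupoid.inv k) b : A) ∈ α.D (Groupoid.inv g) := by
          rw [← hinv]; exact α.act_mem_comp h _ b.2
        -- The second leg absorbs `b δ_h` and becomes a scalar times the leg for `g`, so
        -- balancedness moves `α_{k⁻¹}(b 1_k)` to the first leg.
        have h1 : single α (Groupoid.inv k) ⟨_, α.e_mem (Groupoid.inv k)⟩ * single α h b =
            incl α (α.act (Groupoid.inv k) b) *
              single α (Groupoid.inv g) ⟨_, α.e_mem (Groupoid.inv g)⟩ := by
          rw [single_mul_single, incl_mul_single]
          refine single_congr α hinv ?_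
          change α.e (Groupoid.inv k) * α.act (Groupoid.inv k) b =
            α.act (Groupoid.inv k) b * α.e (Groupoid.inv g)
          rw [α.e_mul_of_mem _ (Subtype.prop _), α.mul_e_of_mem _ hmem]
        rw [h1, ← hB, single_mul_incl, single_mul_single]
        congr 2
        refine single_congr α hk ?_
        change (b : A) * α.act h (α.act g c) =
          (α.act k c * α.act k (α.act (Groupoid.inv k) b) : α.D k)
        have hkk : Groupoid.inv k ≫ k = 𝟙 z := by simp
        -- Centrality of `c` puts the moved scalar in front, where `α_k α_{k⁻¹}` returns `b 1_k`;
        -- the factor `1_k` is absorbed by `α_k(c 1_{k⁻¹})`.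
        rw [← α.act_mul, hc, α.act_mul, NonUnitalSubring.val_mul, α.act_act, α.act_act, hk, hkk,
          α.act_id, α.mul_e_of_mem _ (α.D_le _ b.2), ← mul_assoc, α.mul_e_of_mem h b.2,
          ← α.e_comm, mul_assoc, α.e_mul_of_mem k (Subtype.prop _)]
      · intro z' _ hz'
        rw [Fintype.sum_sigma]
        refine Finset.sum_eq_zero fun p _ => Finset.sum_eq_zero fun g _ => ?_
        rw [single_mul_single_of_ne _ _ _ hz'.symm, map_zero]
      · simp
      · intro y' _ hy'
        rw [Fintype.sum_sigma]
        refine Finset.sum_eq_zero fun p _ => Finset.sum_eq_zero fun g _ => ?_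
        rw [single_mul_single_of_ne _ _ _ hy', map_zero, AddMonoidHom.zero_apply]
      · simp

end SkewRing

end

end UnitalPartialGroupoidAction

theorem mainTheorem4 {Ob : Type u} [Groupoid.{v} Ob] [Fintype Ob] [DecidableEq Ob]
    [∀ y z : Ob, Fintype (y ⟶ z)] {A : Type w} [NonUnitalRing A]
    (α : UnitalPartialGroupoidAction Ob A)
    (hA : DirectSum.IsInternal fun y : Ob => α.D (𝟙 y))
    (x : Ob) (τ : ∀ y : Ob, x ⟶ y) (hτx : τ x = 𝟙 x)
    (hτ : ∀ y : Ob, α.D (Groupoid.inv (τ y)) = α.D (𝟙 x) ∧ α.D (τ y) = α.D (𝟙 y))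
    (h₁ : ∃ a ∈ NonUnitalSubring.center (α.D (𝟙 x)), α.trace x (a : A) = α.e (𝟙 x))
    (h₂ : ∃ a ∈ NonUnitalSubring.center A,
      ∑ z : Ob, (α.act (Groupoid.inv (τ z)) (a * α.e (𝟙 z)) : A) = α.e (𝟙 x)) :
    IsLeftSemisimpleExtension.{w, max u v w, w'} (UnitalPartialGroupoidAction.SkewRing.incl α) ∧
      IsRightSemisimpleExtension.{w, max u v w, w'}
        (UnitalPartialGroupoidAction.SkewRing.incl α) := by
  obtain ⟨c, hc, htr⟩ := α.exists_trace_eq_e hA x τ hτ h₁ h₂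
  have h := UnitalPartialGroupoidAction.SkewRing.isSeparabilityElement.{u, v, w, w'} α hc htr
  exact ⟨h.isLeftSemisimpleExtension, h.isRightSemisimpleExtension⟩
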